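/- Let $N\cong\mathbb Z^d$ be a lattice, $N_{\mathbb R}=N\otimes\mathbb R$, and $M=\operatorname{Hom}(N,\mathbb Z)$. For a polyhedron $Q\subseteq N_{\mathbb R}$ put $\operatorname{tail}(Q)=\{a: a+Q\subseteq Q\}$ and, for a linear form $c$, $\operatorname{face}(Q,c)=\{a\in Q:\langle c,a\rangle=\min\langle c,Q\rangle\}$. Let $P\subseteq N_{\mathbb R}$ be a rational polyhedron with at least one vertex, with vertices $v^1,\dots,v^{\mathsf m}$ and compact edges $d_1,\dots,d_{\mathsf r}$. *The lattice $T_{\mathbb Z}(P)$.* For an oriented compact edge $[v,w]$ let $g\ge1$ be the least integer such that the affine line through $gv$ and $gw$ contains a point of $N$; the half open edge $[v,w)$ is called short if $\#\big(g\cdot[v,w)\cap N\big)\le g-1$. Let $T(P)\subseteq\mathbb R^{\mathsf r}\oplus\mathbb R^{\mathsf m}$ be the subspace of all $(t,s)$ such that - $\sum_{d\subset F}\varepsilon_F(d)\,t_d\,\vec d=0$ for every compact two-dimensional face $F$ of $P$, where the signs $\varepsilon_F(d)=\pm1$ make the edge vectors $\varepsilon_F(d)\vec d$ an oriented cycle along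 $\partial F$; - $s_v=0$ for every vertex $v\in N$; - $s_v=s_w$ for every compact edge $[v,w]$ with $[v,w]\cap N=\emptyset$; - $s_v=t_{vw}$ for every short half open edge $[v,w)$. Let $T_{\mathbb Z}(P)$ be the subgroup of those $(t,s)\in T(P)$ with $s_v\in\mathbb Z$ for all vertices $v$ and $(t_{vw}-s_v)v-(t_{vw}-s_w)w\in N$ for all compact edges $[v,w]$. *The Kodaira–Spencer evaluation.* Let $Q$ be a Minkowski summand of $P$ with $\operatorname{tail}(Q)=\operatorname{tail}(P)$. For a vertex $v$ of $P$, written $\{v\}=\operatorname{face}(P,c)$, let $v(Q)$ be the corresponding vertex of $Q$, $\{v(Q)\}=\operatorname{face}(Q,c)$ (it does not depend on $c$). Put $\kappa(Q)=(t(Q),s(Q))\in\mathbb R_{\ge0}^{\mathsf r}\oplus\mathbb R^{\mathsf m}$, where $t_{vw}(Q)\ge0$ is the dilation factor of the compact edge $[v,w]$, given by $w(Q)-v(Q)=t_{vw}(Q)\,(w-v)$, and $s_v(Q)=0$ if $v(Q)\in N$ and $s_v(Q)=1$ if $v(Q)\notin N$. Let $\mathbb 1\in\mathbb R^{\mathsf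 r}\oplus\mathbb R^{\mathsf m}$ be the element with $t_d=1$ for all compact edges $d$, $s_v=0$ for the vertices $v\in N$, and $s_v=1$ for the vertices $v\notin N$. **Theorem.** Let $m\ge0$ and let $P=P_0+\dots+P_m$ be a Minkowski decomposition into polyhedra with $\operatorname{tail}(P_i)=\operatorname{tail}(P)$ for all $i$. Then $\kappa(P)=\mathbb 1$. Moreover, the decomposition is lattice friendly, i.e. all summands share the same tail cone and for every $c\in\operatorname{tail}(P)^\vee\cap M$ there is an index $\mu$ such that $\operatorname{face}(P_i,c)$ contains a point of $N$ for every $i\ne\mu$, if and only if $$\kappa(P)=\kappa(P_0)+\dots+\kappa(P_m)\quad\text{and}\quad \kappa(P_i)\in T_{\mathbb Z}(P)\ \text{ for all } i=0,\dots,m.$$ -/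

import Mathlib

open scoped Pointwise

namespace LatticeMinkowski

variable {V : Type*} [NormedAddCommGroup V] [NormedSpace ℝ V]

/-- A convex polyhedron: an intersection of finitely many closed half-spaces. -/
def IsPolyhedron (P : Set V) : Prop :=
  ∃ S : Finset (Module.Dual ℝ V × ℝ), P = {x | ∀ p ∈ S, p.2 ≤ p.1 x}

/-- `c` lies in the dual lattice `M = Hom(N, ℤ)`, seen inside the dual of `V = N ⊗ ℝ`. -/
def IsIntegralForm (N : Submodule ℤ V) (c : Module.Dual ℝ V) : Prop :=
  ∀ n ∈ N, ∃ k : ℤ, c n = k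

/-- `c` lies in `M ⊗ ℚ = Hom(N, ℚ)`. -/
def IsRationalForm (N : Submodule ℤ V) (c : Module.Dual ℝ V) : Prop :=
  ∀ n ∈ N, ∃ q : ℚ, c n = q

/-- A rational polyhedron: an intersection of finitely many half-spaces given by linear
inequalities with rational coefficients. -/
def IsRationalPolyhedron (N : Submodule ℤ V) (P : Set V) : Prop :=
  ∃ S : Finset (Module.Dual ℝ V × ℚ),
    (∀ p ∈ S, IsRationalForm N p.1) ∧ P = {x | ∀ p ∈ S, (p.2 : ℝ) ≤ p.1 x}

/-- The tail cone `{a : a + P ⊆ P}`. -/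
def tail (P : Set V) : Set V := {a | ∀ p ∈ P, a + p ∈ P}

/-- The dual cone of a set: the linear forms that are nonnegative on it. -/
def dualCone (C : Set V) : Set (Module.Dual ℝ V) := {c | ∀ a ∈ C, 0 ≤ c a}

/-- `face P c` is the set of points of `P` where the linear form `c` attains its minimum. -/
def face (P : Set V) (c : Module.Dual ℝ V) : Set V := {a | a ∈ P ∧ ∀ b ∈ P, c a ≤ c b}

/-- The (nonempty) faces of `P`. -/
def IsFace (P F : Set V) : Prop := F.Nonempty ∧ ∃ c : Module.Dual ℝ V, F = face P c

/-- The vertices of `P`: its zero-dimensional faces. -/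
def vertices (P : Set V) : Set V := {v | IsFace P {v}}

/-- The compact edges of `P`: the faces that are segments `[v, w]` between two different
vertices of `P`. -/
def compactEdges (P : Set V) : Set (Set V) :=
  {e | IsFace P e ∧ ∃ v ∈ vertices P, ∃ w ∈ vertices P, v ≠ w ∧ e = segment ℝ v w}

/-- The compact two-dimensional faces of `P`. -/
def compactTwoFaces (P : Set V) : Set (Set V) :=
  {F | IsFace P F ∧ IsCompact F ∧ Module.finrank ℝ (vectorSpan ℝ F) = 2}

/-- An oriented closed walk `u 0, u 1, …, u n = u 0` with `u 0, …, u (n - 1)` distinct, whose steps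
are edges of `P` and run exactly through all the edges contained in `F`. For a compact two-face `F`
these are the traversals of the boundary polygon, in one of its two orientations. -/
structure BoundaryCycle (P F : Set V) where
  n : ℕ
  three_le : 3 ≤ n
  u : ℕ → V
  closed : u n = u 0
  injOn : Set.InjOn u (Set.Iio n)
  edge_mem : ∀ k < n, segment ℝ (u k) (u (k + 1)) ∈ compactEdges P
  subset_iff : ∀ e ∈ compactEdges P, e ⊆ F ↔ ∃ k < n, e = segment ℝ (u k) (u (k + 1))

/-- The coordinate space `ℝ^r ⊕ ℝ^m`, whose elements `(t, s)` have one coordinate `t_e` for each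
compact edge and one coordinate `s_v` for each vertex of `P`. -/
abbrev Params (P : Set V) : Type _ := (compactEdges P → ℝ) × (vertices P → ℝ)

/-- The space `V(P)` of edge parameters that satisfy the closing condition
`∑ ε_F(d) t_d d = 0` around every compact two-face `F`. The signed edge vectors `ε_F(d) d` are
the steps `u (k + 1) - u k` of the boundary cycle; reversing the orientation changes the sum only
by a sign. -/
def edgeSpace (P : Set V) : Submodule ℝ (compactEdges P → ℝ) where
  carrier := {t | ∀ F ∈ compactTwoFaces P, ∀ z : BoundaryCycle P F,
    ∑ k : Fin z.n, t ⟨segment ℝ (z.u k) (z.u (k + 1)), z.edge_mem k k.2⟩ •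
      (z.u (k + 1) - z.u k) = 0}
  add_mem' := by
    intro a b ha hb F hF z
    simp only [Pi.add_apply, add_smul, Finset.sum_add_distrib]
    rw [ha F hF z, hb F hF z, add_zero]
  zero_mem' := by
    intro F hF z
    simp
  smul_mem' := by
    intro r a ha F hF z
    simp only [Pi.smul_apply, smul_eq_mul, mul_smul, ← Finset.smul_sum]
    rw [ha F hF z, smul_zero]

/-- The half open segment `[v, w)`. -/
def halfOpen (v w : V) : Set V := AffineMap.lineMap v w '' Set.Ico (0 : ℝ) 1

/-- The least integer `g ≥ 1` such that the affine line through `g v` and `g w` contains a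
lattice point. -/
noncomputable def edgeIndex (N : Submodule ℤ V) (v w : V) : ℕ :=
  sInf {g : ℕ | 1 ≤ g ∧ ∃ x ∈ N, x ∈ line[ℝ, (g : ℝ) • v, (g : ℝ) • w]}

/-- The half open edge `[v, w)` is short: `#(g · [v, w) ∩ N) ≤ g - 1` for `g = edgeIndex N v w`. -/
def IsShort (N : Submodule ℤ V) (v w : V) : Prop :=
  (((edgeIndex N v w : ℝ) • halfOpen v w) ∩ (N : Set V)).ncard + 1 ≤ edgeIndex N v w

/-- The real vector space `T(P) ⊆ ℝ^r ⊕ ℝ^m`. -/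
def paramSpace (N : Submodule ℤ V) (P : Set V) : Submodule ℝ (Params P) where
  carrier := {ξ | ξ.1 ∈ edgeSpace P ∧
    (∀ v : vertices P, (v : V) ∈ N → ξ.2 v = 0) ∧
    (∀ v w : vertices P, segment ℝ (v : V) w ∈ compactEdges P →
      segment ℝ (v : V) w ∩ (N : Set V) = ∅ → ξ.2 v = ξ.2 w) ∧
    (∀ (v w : vertices P) (h : segment ℝ (v : V) w ∈ compactEdges P),
      IsShort N (v : V) w → ξ.2 v = ξ.1 ⟨segment ℝ (v : V) w, h⟩)}
  add_mem' := by
    rintro a b ⟨ha, ha1, ha2, ha3⟩ ⟨hb, hb1, hb2, hb3⟩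
    refine ⟨add_mem ha hb, fun v hv => ?_, fun v w h h' => ?_, fun v w h h' => ?_⟩
    · simp [ha1 v hv, hb1 v hv]
    · simp [ha2 v w h h', hb2 v w h h']
    · simp [ha3 v w h h', hb3 v w h h']
  zero_mem' := by
    refine ⟨zero_mem _, fun v hv => ?_, fun v w h h' => ?_, fun v w h h' => ?_⟩ <;> simp
  smul_mem' := by
    rintro r a ⟨ha, ha1, ha2, ha3⟩
    refine ⟨Submodule.smul_mem _ r ha, fun v hv => ?_, fun v w h h' => ?_, fun v w h h' => ?_⟩
    · simp [ha1 v hv]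
    · simp [ha2 v w h h']
    · simp [ha3 v w h h']

/-- The lattice `T_ℤ(P) ⊆ T(P)`. -/
def paramLattice (N : Submodule ℤ V) (P : Set V) : AddSubgroup (Params P) where
  carrier := {ξ | ξ ∈ paramSpace N P ∧
    (∀ v : vertices P, ∃ k : ℤ, ξ.2 v = k) ∧
    (∀ (v w : vertices P) (h : segment ℝ (v : V) w ∈ compactEdges P),
      (ξ.1 ⟨segment ℝ (v : V) w, h⟩ - ξ.2 v) • (v : V)
        - (ξ.1 ⟨segment ℝ (v : V) w, h⟩ - ξ.2 w) • (w : V) ∈ N)}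
  add_mem' := by
    rintro a b ⟨ha, ha1, ha2⟩ ⟨hb, hb1, hb2⟩
    refine ⟨add_mem ha hb, fun v => ?_, fun v w h => ?_⟩
    · obtain ⟨k, hk⟩ := ha1 v
      obtain ⟨l, hl⟩ := hb1 v
      exact ⟨k + l, by simp [hk, hl]⟩
    · have := add_mem (ha2 v w h) (hb2 v w h)
      convert this using 1
      simp only [Prod.fst_add, Prod.snd_add, Pi.add_apply]
      module
  zero_mem' := by
    refine ⟨zero_mem _, fun v => ⟨0, by simp⟩, fun v w h => ?_⟩
    simp
  neg_mem' := by
    rintro a ⟨ha, ha1, ha2⟩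
    refine ⟨neg_mem ha, fun v => ?_, fun v w h => ?_⟩
    · obtain ⟨k, hk⟩ := ha1 v
      exact ⟨-k, by simp [hk]⟩
    · have := neg_mem (ha2 v w h)
      convert this using 1
      simp only [Prod.fst_neg, Prod.snd_neg, Pi.neg_apply]
      module

open Classical in
/-- The distinguished element `𝟙` of `T(P)`: all `t_e = 1`, and `s_v` is `0` or `1` according to
whether `v` is a lattice point or not. -/
noncomputable def oneParam (N : Submodule ℤ V) (P : Set V) : Params P :=
  (fun _ => 1, fun v => if (v : V) ∈ N then 0 else 1)

/-- The relation saying that `x` is the vertex of `Q` that corresponds to the vertex `v` of `P`. -/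
def IsVertexIn (P Q : Set V) (v x : V) : Prop :=
  ∃ c : Module.Dual ℝ V, face P c = {v} ∧ face Q c = {x}

/-- For a vertex `v = face P c` of `P` and a Minkowski summand `Q` of `P`, the corresponding vertex
`v(Q) = face Q c` of `Q`. -/
noncomputable def vertexIn (P Q : Set V) (v : V) : V :=
  Classical.epsilon fun x => IsVertexIn P Q v x

/-- For a Minkowski summand, the corresponding vertex exists and is unique: it does not depend on
the linear form that is chosen. -/
theorem existsUnique_isVertexIn {P Q Q' : Set V} (h : P = Q + Q') {v : V} (hv : v ∈ vertices P) :
    ∃! x, IsVertexIn P Q v x := by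
  obtain ⟨-, c, hc⟩ := hv
  have hvP : v ∈ P := by
    have : v ∈ face P c := hc ▸ Set.mem_singleton v
    exact this.1
  obtain ⟨x, hx, y, hy, hxy⟩ := Set.mem_add.1 (h ▸ hvP)
  have key : ∀ c' : Module.Dual ℝ V, face P c' = {v} → face Q c' = {x} := by
    intro c' hc'
    have hvm : v ∈ face P c' := hc' ▸ Set.mem_singleton v
    have hle : ∀ b ∈ Q, c' x ≤ c' b := by
      intro b hb
      have h1 := hvm.2 (b + y) (h ▸ Set.add_mem_add hb hy)
      rw [← hxy, map_add, map_add] at h1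
      linarith
    ext z
    constructor
    · rintro ⟨hz, hz'⟩
      have h2 : z + y ∈ face P c' := by
        refine ⟨h ▸ Set.add_mem_add hz hy, fun b hb => le_trans ?_ (hvm.2 b hb)⟩
        rw [← hxy, map_add, map_add]
        linarith [hz' x hx]
      rw [hc', Set.mem_singleton_iff, ← hxy] at h2
      exact add_right_cancel h2
    · rintro rfl
      exact ⟨hx, hle⟩
  refine ⟨x, ⟨c, hc.symm, key c hc.symm⟩, ?_⟩
  rintro x' ⟨c', hc', hx'⟩
  exact Set.singleton_injective (hx'.symm.trans (key c' hc'))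

/-- `t` is a dilation factor of the edge `e` of `P` inside `Q`: it is nonnegative and
`w(Q) - v(Q) = t (w - v)` for the vertices `v`, `w` with `e = [v, w]`. -/
def IsDilationFactor (P Q e : Set V) (t : ℝ) : Prop :=
  0 ≤ t ∧ ∀ v ∈ vertices P, ∀ w ∈ vertices P, e = segment ℝ v w →
    vertexIn P Q w - vertexIn P Q v = t • (w - v)

/-- The dilation factor of the edge `e` of `P` inside the Minkowski summand `Q`. -/
noncomputable def dilationFactor (P Q e : Set V) : ℝ :=
  Classical.epsilon fun t => IsDilationFactor P Q e t

theorem vertexIn_spec {P Q Q' : Set V} (h : P = Q + Q') {v : V} (hv : v ∈ vertices P) :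
    IsVertexIn P Q v (vertexIn P Q v) :=
  Classical.epsilon_spec (existsUnique_isVertexIn h hv).exists

/-- For a Minkowski summand, every compact edge has exactly one dilation factor, and it lies in
`[0, 1]`. -/
theorem existsUnique_isDilationFactor {P Q Q' : Set V} (h : P = Q + Q') {e : Set V}
    (he : e ∈ compactEdges P) : (∃! t, IsDilationFactor P Q e t) ∧ dilationFactor P Q e ≤ 1 := by
  obtain ⟨⟨-, c, hc⟩, v, hv, w, hw, hvw, hes⟩ := he
  have h' : P = Q' + Q := by rw [h, add_comm]
  have hadd : ∀ u ∈ vertices P, vertexIn P Q u + vertexIn P Q' u = u := by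
    intro u hu
    obtain ⟨-, c', hc'⟩ := id hu
    have huP : u ∈ face P c' := hc' ▸ Set.mem_singleton u
    obtain ⟨x, hx, y, hy, hxy⟩ := Set.mem_add.1 (h ▸ huP.1)
    have e1 : IsVertexIn P Q u x := by
      refine ⟨c', hc'.symm, ?_⟩
      ext z
      refine ⟨fun ⟨hz, hz'⟩ => ?_, ?_⟩
      · have h2 : z + y ∈ face P c' := by
          refine ⟨h ▸ Set.add_mem_add hz hy, fun b hb => le_trans ?_ (huP.2 b hb)⟩
          rw [← hxy, map_add, map_add]
          linarith [hz' x hx]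
        rw [← hc', Set.mem_singleton_iff, ← hxy] at h2
        exact add_right_cancel h2
      · rintro rfl
        refine ⟨hx, fun b hb => ?_⟩
        have h1 := huP.2 (b + y) (h ▸ Set.add_mem_add hb hy)
        rw [← hxy, map_add, map_add] at h1
        linarith
    have e2 : IsVertexIn P Q' u y := by
      refine ⟨c', hc'.symm, ?_⟩
      ext z
      refine ⟨fun ⟨hz, hz'⟩ => ?_, ?_⟩
      · have h2 : x + z ∈ face P c' := by
          refine ⟨h ▸ Set.add_mem_add hx hz, fun b hb => le_trans ?_ (huP.2 b hb)⟩
          rw [← hxy, map_add, map_add]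
          linarith [hz' y hy]
        rw [← hc', Set.mem_singleton_iff, ← hxy] at h2
        exact add_left_cancel h2
      · rintro rfl
        refine ⟨hy, fun b hb => ?_⟩
        have h1 := huP.2 (x + b) (h ▸ Set.add_mem_add hx hb)
        rw [← hxy, map_add, map_add] at h1
        linarith
    rw [(existsUnique_isVertexIn h hu).unique (vertexIn_spec h hu) e1,
      (existsUnique_isVertexIn h' hu).unique (vertexIn_spec h' hu) e2, hxy]
  have hmemQ : ∀ u ∈ vertices P, vertexIn P Q u ∈ Q := by
    intro u hu
    obtain ⟨c', -, h2⟩ := vertexIn_spec h hu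
    exact (h2 ▸ Set.mem_singleton _ : vertexIn P Q u ∈ face Q c').1
  have hmemQ' : ∀ u ∈ vertices P, vertexIn P Q' u ∈ Q' := by
    intro u hu
    obtain ⟨c', -, h2⟩ := vertexIn_spec h' hu
    exact (h2 ▸ Set.mem_singleton _ : vertexIn P Q' u ∈ face Q' c').1
  have hvf : v ∈ face P c := by rw [← hc, hes]; exact left_mem_segment ℝ v w
  have hwf : w ∈ face P c := by rw [← hc, hes]; exact right_mem_segment ℝ v w
  have m1 : vertexIn P Q w + vertexIn P Q' v ∈ P :=
    (Set.ext_iff.1 h _).2 <| Set.add_mem_add (hmemQ w hw) (hmemQ' v hv)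
  have m2 : vertexIn P Q v + vertexIn P Q' w ∈ P :=
    (Set.ext_iff.1 h _).2 <| Set.add_mem_add (hmemQ v hv) (hmemQ' w hw)
  have m3 : vertexIn P Q w + vertexIn P Q' v ∈ segment ℝ v w := by
    rw [← hes, hc]
    refine ⟨m1, fun b hb => le_trans ?_ (hvf.2 b hb)⟩
    have a1 := hwf.2 _ m2
    have b1 := congrArg c (hadd v hv)
    have b2 := congrArg c (hadd w hw)
    have b3 := hwf.2 v hvf.1
    have b4 := hvf.2 w hwf.1
    simp only [map_add] at *
    linarith
  rw [segment_eq_image'] at m3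
  obtain ⟨t, ⟨ht0, ht1⟩, ht⟩ := m3
  have hdiff : vertexIn P Q w - vertexIn P Q v = t • (w - v) := by
    have b1 := hadd v hv
    have : t • (w - v) = vertexIn P Q w + vertexIn P Q' v - v := by rw [← ht]; simp
    rw [this]
    nth_rewrite 3 [← b1]
    abel
  have hend : ∀ u ∈ vertices P, u ∈ segment ℝ v w → u = v ∨ u = w := by
    rintro u ⟨-, c', hc'⟩ hu
    have huP : u ∈ face P c' := hc' ▸ Set.mem_singleton u
    rw [segment_eq_image'] at hu
    obtain ⟨r, ⟨hr0, hr1⟩, hr⟩ := hu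
    have hcr : c' u = c' v + r * (c' w - c' v) := by rw [← hr]; simp
    have l1 := huP.2 v hvf.1
    have l2 := huP.2 w hwf.1
    by_cases hvu : c' v ≤ c' u
    · left
      have : v ∈ ({u} : Set V) := hc' ▸ ⟨hvf.1, fun b hb => hvu.trans (huP.2 b hb)⟩
      exact (Set.mem_singleton_iff.1 this).symm
    · right
      have hwu : c' w ≤ c' u := by
        by_contra hcon
        push Not at hvu hcon
        rcases hr0.eq_or_lt with h0 | h0
        · rw [← h0] at hcr
          linarith
        · nlinarith [mul_pos h0 (sub_pos.2 hcon),
            mul_nonneg (sub_nonneg.2 hr1) (sub_pos.2 hvu).le]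
      have : w ∈ ({u} : Set V) :=
        hc' ▸ ⟨hwf.1, fun b hb => le_trans hwu (huP.2 b hb)⟩
      exact (Set.mem_singleton_iff.1 this).symm
  have hT : IsDilationFactor P Q e t := by
    refine ⟨ht0, fun a ha b hb hab => ?_⟩
    have h1 : a ∈ segment ℝ v w := by rw [← hes, hab]; exact left_mem_segment ℝ a b
    have h2 : b ∈ segment ℝ v w := by rw [← hes, hab]; exact right_mem_segment ℝ a b
    rcases hend a ha h1 with rfl | rfl <;> rcases hend b hb h2 with rfl | rfl
    · simp
    · exact hdiff
    · rw [← neg_sub, hdiff, ← smul_neg, neg_sub]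
    · simp
  have huniq : ∀ t', IsDilationFactor P Q e t' → t' = t := by
    rintro t' ⟨-, h2⟩
    have h3 := (h2 v hv w hw hes).symm.trans hdiff
    exact smul_left_injective ℝ (sub_ne_zero.2 hvw.symm) h3
  refine ⟨⟨t, hT, huniq⟩, ?_⟩
  have : dilationFactor P Q e = t := huniq _ (Classical.epsilon_spec ⟨t, hT⟩)
  linarith

open Classical in
/-- The Kodaira-Spencer evaluation `κ(Q) = (t(Q), s(Q))` of a Minkowski summand `Q` of `P`. -/
noncomputable def kodairaSpencer (N : Submodule ℤ V) (P Q : Set V) : Params P :=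
  (fun e => dilationFactor P Q e, fun v => if vertexIn P Q v ∈ N then 0 else 1)

/-- The Minkowski decomposition of `P` into the summands `Q i` is lattice friendly. -/
def IsLatticeFriendly (N : Submodule ℤ V) (P : Set V) {m : ℕ} (Q : Fin (m + 1) → Set V) : Prop :=
  (∀ i j, tail (Q i) = tail (Q j)) ∧
  ∀ c ∈ dualCone (tail P), IsIntegralForm N c →
    ∃ μ : Fin (m + 1), ∀ i, i ≠ μ → (face (Q i) c ∩ (N : Set V)).Nonempty

end LatticeMinkowski

/-!
Let `v(Q i)` be the vertex of the summand `Q i` that corresponds to the vertex `v` of `P`. Then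
`v = ∑ i, v(Q i)` (`sum_vertexIn`), and more generally the points of `Q i` that add up to a point of
`face P c` lie in `face (Q i) c`. The equation `κ(P) = ∑ i, κ(Q i)` therefore always holds in the
coordinates `t`, and in the coordinate `s_v` it says that the number of `i` with `v(Q i) ∉ N` is
zero for `v ∈ N` and one for `v ∉ N`.

If the equation holds and `c` is nonnegative on the tail cone of `P`, then `face P c` contains a
vertex `v` (`exists_vertex_mem_face`), and the points `v(Q i) ∈ face (Q i) c`, all but at most one of
them in `N`, show that the decomposition is lattice friendly.

Conversely, the sum of the inequalities that are tight at a relative interior point of a face exposes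
that face, so that every vertex and every compact edge of a rational polyhedron is exposed by an
integral form (`exists_isIntegralForm_face_eq`). Testing a lattice friendly decomposition on the form
of a vertex `v` shows that at most one `v(Q i)` is not in `N`, which gives the equation. Testing it on
the form of an edge `[v, w]` without lattice points shows that the exceptional index is the same for
`v` and `w`, as otherwise the edge would contain a sum of lattice points. If `[v, w)` is short, then
the lattice length of `[v, w]` is less than one (`IsShort.smul_sub_notMem`), and a summand with
`v(Q i) ∈ N` also has `w(Q i) ∈ N`, so it contracts the edge; as the dilation factors of an edge add up
to one, the exceptional summand has dilation factor one. The closing conditions hold since the edges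
of a summand are differences of its vertices, and the integrality condition on `[v, w]` says that
`(v(Q i) - s_v v) - (w(Q i) - s_w w)` is in `N`, where both terms are lattice points.
-/

namespace LatticeMinkowski

/-! ### Systems of linear inequalities -/

section Polyhedron

variable {V : Type*} [NormedAddCommGroup V] [NormedSpace ℝ V]
variable {ι : Type*} {S : Finset ι} {f : ι → Module.Dual ℝ V} {b : ι → ℝ} {P : Set V}

open Classical in
/-- The sum of the left-hand sides of the inequalities `b i ≤ f i`, `i ∈ S`, that are tight
at `x`. -/
noncomputable def activeSum (S : Finset ι) (f : ι → Module.Dual ℝ V) (b : ι → ℝ) (x : V) :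
    Module.Dual ℝ V :=
  ∑ i ∈ S with f i x = b i, f i

/-- The form `activeSum S f b x` exposes the smallest face that contains `x`: the points at which
all the inequalities tight at `x` are tight. -/
theorem mem_face_activeSum_iff (hP : P = {x | ∀ i ∈ S, b i ≤ f i x}) {x y : V} (hx : x ∈ P) :
    y ∈ face P (activeSum S f b x) ↔ y ∈ P ∧ ∀ i ∈ S, f i x = b i → f i y = b i := by
  classical
  have hmem : ∀ z ∈ P, ∀ i ∈ S, b i ≤ f i z := fun z hz => by rw [hP] at hz; exact hz
  have hval : ∀ z, activeSum S f b x z = ∑ i ∈ S with f i x = b i, f i z := fun z => by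
    simp [activeSum, LinearMap.sum_apply]
  have hlow : ∀ z ∈ P, ∑ i ∈ S with f i x = b i, b i ≤ activeSum S f b x z := fun z hz => by
    rw [hval]
    exact Finset.sum_le_sum fun i hi => hmem z hz i (Finset.mem_filter.1 hi).1
  have hxv : activeSum S f b x x = ∑ i ∈ S with f i x = b i, b i := by
    rw [hval]
    exact Finset.sum_congr rfl fun i hi => (Finset.mem_filter.1 hi).2
  constructor
  · rintro ⟨hy, hmin⟩
    refine ⟨hy, fun i hi hxi => ?_⟩
    have heq : ∑ i ∈ S with f i x = b i, b i = ∑ i ∈ S with f i x = b i, f i y := by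
      rw [← hval]
      exact le_antisymm (hlow y hy) (hxv ▸ hmin x hx)
    exact ((Finset.sum_eq_sum_iff_of_le
      fun j hj => hmem y hy j (Finset.mem_filter.1 hj).1).1 heq i
        (Finset.mem_filter.2 ⟨hi, hxi⟩)).symm
  · rintro ⟨hy, htight⟩
    refine ⟨hy, fun z hz => ?_⟩
    have : activeSum S f b x y = ∑ i ∈ S with f i x = b i, b i := by
      rw [hval]
      exact Finset.sum_congr rfl fun i hi =>
        htight i (Finset.mem_filter.1 hi).1 (Finset.mem_filter.1 hi).2
    exact this ▸ hlow z hz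

/-- Inside the smallest face containing `x`, a segment ending in `x` can be prolonged beyond
`x`. -/
theorem exists_pos_add_smul_sub_mem (hP : P = {x | ∀ i ∈ S, b i ≤ f i x}) {x y : V} (hx : x ∈ P)
    (hy : ∀ i ∈ S, f i x = b i → f i y = b i) : ∃ ε > (0 : ℝ), x + ε • (x - y) ∈ P := by
  have hx' : ∀ i ∈ S, b i ≤ f i x := by rw [hP] at hx; exact hx
  have hev : ∀ᶠ ε : ℝ in nhdsWithin 0 (Set.Ioi 0), ∀ i ∈ S, b i ≤ f i (x + ε • (x - y)) := by
    rw [Filter.eventually_all_finset]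
    intro i hi
    by_cases h : f i x = b i
    · exact Filter.Eventually.of_forall fun ε => by simp [h, hy i hi h]
    · have hlt : b i < f i x := lt_of_le_of_ne (hx' i hi) (Ne.symm h)
      have hcont : Continuous fun ε : ℝ => f i x + ε * (f i x - f i y) := by fun_prop
      have h0 : b i < (fun ε : ℝ => f i x + ε * (f i x - f i y)) 0 := by simpa using hlt
      filter_upwards [nhdsWithin_le_nhds (hcont.tendsto 0 (Ioi_mem_nhds h0))] with ε hε
      simpa using le_of_lt hε
  obtain ⟨ε, hε, hpos⟩ := (hev.and self_mem_nhdsWithin).exists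
  exact ⟨ε, hpos, hP ▸ hε⟩

/-- A face is exposed by the sum of the inequalities that are tight at a point of its relative
interior. -/
theorem face_activeSum_eq (hP : P = {x | ∀ i ∈ S, b i ≤ f i x}) {c : Module.Dual ℝ V} {x : V}
    (hx : x ∈ face P c) (hint : ∀ y ∈ face P c, ∃ ε > (0 : ℝ), x + ε • (x - y) ∈ P) :
    face P (activeSum S f b x) = face P c := by
  have hmem : ∀ z ∈ P, ∀ i ∈ S, b i ≤ f i z := fun z hz => by rw [hP] at hz; exact hz
  ext y
  rw [mem_face_activeSum_iff hP hx.1]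
  constructor
  · rintro ⟨hy, htight⟩
    obtain ⟨ε, hε, hmem'⟩ := exists_pos_add_smul_sub_mem hP hx.1 htight
    have h1 := hx.2 _ hmem'
    simp only [map_add, map_smul, map_sub, smul_eq_mul] at h1
    have h2 : 0 ≤ c x - c y := by
      by_contra h
      nlinarith [mul_pos hε (sub_pos.2 (not_le.1 h))]
    exact ⟨hy, fun z hz => le_trans (by linarith) (hx.2 z hz)⟩
  · intro hy
    refine ⟨hy.1, fun i hi hxi => ?_⟩
    obtain ⟨ε, hε, hmem'⟩ := hint y hy
    have h1 := hmem _ hmem' i hi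
    have h2 := hmem y hy.1 i hi
    simp only [map_add, map_smul, map_sub, smul_eq_mul, hxi] at h1
    nlinarith

theorem face_activeSum_eq_singleton (hP : P = {x | ∀ i ∈ S, b i ≤ f i x}) {v : V}
    (hv : v ∈ vertices P) : face P (activeSum S f b v) = {v} := by
  obtain ⟨-, c, hc⟩ := hv
  have hvc : v ∈ face P c := hc ▸ Set.mem_singleton v
  rw [hc]
  refine face_activeSum_eq hP hvc fun y hy => ⟨1, one_pos, ?_⟩
  rw [← hc, Set.mem_singleton_iff] at hy
  simpa [hy] using hvc.1

theorem finite_vertices (hP : P = {x | ∀ i ∈ S, b i ≤ f i x}) : (vertices P).Finite := by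
  classical
  refine Set.Finite.of_finite_image (f := fun v => S.filter fun i => f i v = b i)
    (S.powerset.finite_toSet.subset ?_) ?_
  · rintro _ ⟨v, -, rfl⟩
    exact Finset.mem_coe.2 (Finset.mem_powerset.2 (Finset.filter_subset _ _))
  · intro v hv w hw h
    have hvP : ∀ u ∈ vertices P, u ∈ P := by
      rintro u ⟨-, c, hc⟩
      exact (hc ▸ Set.mem_singleton u : u ∈ face P c).1
    have : w ∈ face P (activeSum S f b v) := by
      refine (mem_face_activeSum_iff hP (hvP v hv)).2 ⟨hvP w hw, fun i hi hvi => ?_⟩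
      have : i ∈ S.filter fun i => f i w = b i := by
        have h' : S.filter (fun i => f i v = b i) = S.filter (fun i => f i w = b i) := h
        rw [← h']
        exact Finset.mem_filter.2 ⟨hi, hvi⟩
      exact (Finset.mem_filter.1 this).2
    rw [face_activeSum_eq_singleton hP hv] at this
    exact this.symm

/-- A direction outside the tail cone leads from a point of `P` to a point where an additional
inequality is tight, while those that are constant in this direction stay tight. -/
theorem exists_tight_of_notMem_tail (hP : P = {x | ∀ i ∈ S, b i ≤ f i x}) {x d : V} (hx : x ∈ P)
    (hd : d ∉ tail P) :
    ∃ r : ℝ, 0 ≤ r ∧ x + r • d ∈ P ∧ ∃ i ∈ S, f i d < 0 ∧ f i (x + r • d) = b i := by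
  classical
  have hx' : ∀ i ∈ S, b i ≤ f i x := by rw [hP] at hx; exact hx
  have hne : (S.filter fun i => f i d < 0).Nonempty := by
    by_contra hemp
    rw [Finset.not_nonempty_iff_eq_empty, Finset.filter_eq_empty_iff] at hemp
    refine hd fun p hp => ?_
    rw [hP] at hp ⊢
    intro i hi
    rw [map_add]
    linarith [hp i hi, not_lt.1 (hemp hi)]
  -- The step length of the ratio test.
  obtain ⟨i, hi, hmin⟩ := Finset.exists_min_image _ (fun i => (f i x - b i) / (-f i d)) hne
  obtain ⟨hiS, hid⟩ := Finset.mem_filter.1 hi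
  have hr : 0 ≤ (f i x - b i) / (-f i d) :=
    div_nonneg (sub_nonneg.2 (hx' i hiS)) (by linarith)
  refine ⟨_, hr, ?_, i, hiS, hid, ?_⟩
  · rw [hP]
    intro j hj
    rw [map_add, map_smul, smul_eq_mul]
    by_cases hjd : f j d < 0
    · have h1 := hmin j (Finset.mem_filter.2 ⟨hj, hjd⟩)
      rw [le_div_iff₀ (by linarith)] at h1
      linarith
    · linarith [hx' j hj, mul_nonneg hr (not_lt.1 hjd)]
  · rw [map_add, map_smul, smul_eq_mul]
    have : f i d ≠ 0 := hid.ne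
    field_simp
    ring

/-- From every point of a polyhedron with a vertex one reaches a vertex without increasing a form
that is nonnegative on the tail cone: as long as the point is not a vertex, some direction outside
the tail cone preserves the tight inequalities and does not increase the form, and following it
makes one more inequality tight. -/
theorem exists_vertex_le (hP : P = {x | ∀ i ∈ S, b i ≤ f i x}) (hvert : (vertices P).Nonempty)
    {c : Module.Dual ℝ V} (hc : c ∈ dualCone (tail P)) {x : V} (hx : x ∈ P) :
    ∃ v ∈ vertices P, c v ≤ c x := by
  classical
  induction h : (S.filter fun i => f i x ≠ b i).card using Nat.strong_induction_on
    generalizing x with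
  | _ n ih =>
  by_cases hxv : face P (activeSum S f b x) = {x}
  · exact ⟨x, ⟨Set.singleton_nonempty x, _, hxv.symm⟩, le_rfl⟩
  have hxx : x ∈ face P (activeSum S f b x) :=
    (mem_face_activeSum_iff hP hx).2 ⟨hx, fun _ _ h => h⟩
  obtain ⟨y, hy, hyx⟩ : ∃ y ∈ face P (activeSum S f b x), y ≠ x := by
    by_contra! hcon
    exact hxv (Set.eq_singleton_iff_unique_mem.2 ⟨hxx, hcon⟩)
  have htight := ((mem_face_activeSum_iff hP hx).1 hy).2
  -- `P` contains no line, since it has a vertex.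
  have hline : ∀ d : V, d ≠ 0 → d ∈ tail P → -d ∉ tail P := by
    intro d hd h1 h2
    obtain ⟨v, -, c', hc'⟩ := hvert
    have hv : v ∈ face P c' := hc' ▸ Set.mem_singleton v
    have h3 := hv.2 _ (h2 v hv.1)
    rw [map_add, map_neg] at h3
    have h4 : d + v ∈ face P c' :=
      ⟨h1 v hv.1, fun z hz => le_trans (by rw [map_add]; linarith) (hv.2 z hz)⟩
    rw [← hc', Set.mem_singleton_iff] at h4
    exact hd (by simpa using h4)
  obtain ⟨d, hdc, hdt, hdker⟩ : ∃ d : V, c d ≤ 0 ∧ d ∉ tail P ∧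
      ∀ i ∈ S, f i x = b i → f i d = 0 := by
    have hker : ∀ i ∈ S, f i x = b i → f i (y - x) = 0 := fun i hi h => by
      rw [map_sub, htight i hi h, h, sub_self]
    have hne : y - x ≠ 0 := sub_ne_zero.2 hyx
    have hker' : ∀ i ∈ S, f i x = b i → f i (-(y - x)) = 0 := fun i hi h => by
      rw [map_neg, hker i hi h, neg_zero]
    rcases lt_trichotomy (c (y - x)) 0 with hlt | heq | hgt
    · exact ⟨y - x, hlt.le, fun ht => absurd (hc _ ht) (not_le.2 hlt), hker⟩
    · by_cases ht : y - x ∈ tail P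
      · exact ⟨-(y - x), by rw [map_neg, heq, neg_zero], hline _ hne ht, hker'⟩
      · exact ⟨y - x, heq.le, ht, hker⟩
    · have hneg : c (-(y - x)) < 0 := by rw [map_neg]; linarith
      exact ⟨-(y - x), hneg.le, fun ht => absurd (hc _ ht) (not_le.2 hneg), hker'⟩
  obtain ⟨r, hr, hmem, i, hi, hid, hib⟩ := exists_tight_of_notMem_tail hP hx hdt
  have hcard : (S.filter fun j => f j (x + r • d) ≠ b j).card < n := by
    rw [← h]
    refine Finset.card_lt_card (Finset.ssubset_iff_of_subset ?_ |>.2 ⟨i, ?_, ?_⟩)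
    · intro j hj
      rw [Finset.mem_filter] at hj ⊢
      refine ⟨hj.1, fun hjx => hj.2 ?_⟩
      rw [map_add, map_smul, hdker j hj.1 hjx, smul_zero, add_zero, hjx]
    · exact Finset.mem_filter.2 ⟨hi, fun hix => hid.ne (hdker i hi hix)⟩
    · exact fun hmem' => (Finset.mem_filter.1 hmem').2 hib
  obtain ⟨v, hv, hle⟩ := ih _ hcard hmem rfl
  refine ⟨v, hv, hle.trans ?_⟩
  rw [map_add, map_smul, smul_eq_mul]
  linarith [mul_nonneg hr (neg_nonneg.2 hdc)]

/-- If `P` has a vertex, then a form that is nonnegative on the tail cone attains its minimum at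
a vertex. -/
theorem exists_vertex_mem_face (hP : P = {x | ∀ i ∈ S, b i ≤ f i x})
    (hvert : (vertices P).Nonempty) {c : Module.Dual ℝ V} (hc : c ∈ dualCone (tail P)) :
    ∃ v ∈ vertices P, v ∈ face P c := by
  obtain ⟨v, hv, hmin⟩ := Set.exists_min_image _ c (finite_vertices hP) hvert
  refine ⟨v, hv, ?_, fun x hx => ?_⟩
  · obtain ⟨-, c', hc'⟩ := hv
    exact (hc' ▸ Set.mem_singleton v : v ∈ face P c').1
  · obtain ⟨w, hw, hle⟩ := exists_vertex_le hP hvert hc hx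
    exact (hmin w hw).trans hle

theorem mem_dualCone_tail_of_mem_face {c : Module.Dual ℝ V} {x : V} (hx : x ∈ face P c) :
    c ∈ dualCone (tail P) := by
  intro a ha
  have := hx.2 _ (ha x hx.1)
  rw [map_add] at this
  linarith

end Polyhedron

/-! ### Integral forms and lattice points -/

section Lattice

variable {V : Type*} [NormedAddCommGroup V] [NormedSpace ℝ V] {N : Submodule ℤ V} {P : Set V}

theorem IsRationalForm.sum {ι : Type*} {s : Finset ι} {f : ι → Module.Dual ℝ V}
    (h : ∀ i ∈ s, IsRationalForm N (f i)) : IsRationalForm N (∑ i ∈ s, f i) := by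
  intro n hn
  choose! q hq using fun i hi => h i hi n hn
  exact ⟨∑ i ∈ s, q i, by rw [LinearMap.sum_apply, Finset.sum_congr rfl hq, Rat.cast_sum]⟩

theorem IsRationalForm.exists_isIntegralForm (hN : N.FG) {c : Module.Dual ℝ V}
    (hc : IsRationalForm N c) : ∃ k : ℕ, 0 < k ∧ IsIntegralForm N ((k : ℝ) • c) := by
  obtain ⟨G, rfl⟩ := hN
  choose! q hq using hc
  refine ⟨∏ n ∈ G, (q n).den, Finset.prod_pos fun n _ => (q n).pos, fun n hn => ?_⟩
  induction hn using Submodule.span_induction with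
  | mem x hx =>
    obtain ⟨l, hl⟩ := Finset.dvd_prod_of_mem (fun n => (q n).den) hx
    refine ⟨l * (q x).num, ?_⟩
    rw [hl, LinearMap.smul_apply, hq x (Submodule.subset_span hx), smul_eq_mul]
    have : ((q x : ℚ) : ℝ) * (q x).den = (q x).num := by exact_mod_cast Rat.mul_den_eq_num (q x)
    push_cast
    linear_combination (l : ℝ) * this
  | zero => exact ⟨0, by simp⟩
  | add x y _ _ hx hy =>
    obtain ⟨k, hk⟩ := hx
    obtain ⟨l, hl⟩ := hy
    exact ⟨k + l, by rw [map_add, hk, hl, Int.cast_add]⟩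
  | smul a x _ hx =>
    obtain ⟨k, hk⟩ := hx
    exact ⟨a * k, by rw [map_zsmul, hk, zsmul_eq_mul, Int.cast_mul]⟩

theorem face_smul {c : Module.Dual ℝ V} {r : ℝ} (hr : 0 < r) : face P (r • c) = face P c := by
  ext x
  simp [face, mul_le_mul_iff_right₀ hr]

/-- Every face of a rational polyhedron is exposed by an integral form. The hypothesis `hint` says
that `x` lies in the relative interior of the face. -/
theorem exists_isIntegralForm_face_eq (hN : N.FG) (hP : IsRationalPolyhedron N P)
    {c : Module.Dual ℝ V} {x : V} (hx : x ∈ face P c)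
    (hint : ∀ y ∈ face P c, ∃ ε > (0 : ℝ), x + ε • (x - y) ∈ P) :
    ∃ c', IsIntegralForm N c' ∧ face P c' = face P c := by
  classical
  obtain ⟨S, hS, hPS⟩ := hP
  have hrat : IsRationalForm N (activeSum S Prod.fst (fun p => (p.2 : ℝ)) x) :=
    IsRationalForm.sum fun p hp => hS p (Finset.mem_filter.1 hp).1
  obtain ⟨k, hk, hint'⟩ := hrat.exists_isIntegralForm hN
  exact ⟨_, hint', (face_smul (Nat.cast_pos.2 hk)).trans (face_activeSum_eq hPS hx hint)⟩

theorem exists_isIntegralForm_face_eq_singleton (hN : N.FG) (hP : IsRationalPolyhedron N P) {v : V}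
    (hv : v ∈ vertices P) : ∃ c, IsIntegralForm N c ∧ face P c = {v} := by
  obtain ⟨-, c, hc⟩ := hv
  have hvc : v ∈ face P c := hc ▸ Set.mem_singleton v
  rw [hc]
  refine exists_isIntegralForm_face_eq hN hP hvc fun y hy => ⟨1, one_pos, ?_⟩
  rw [← hc, Set.mem_singleton_iff] at hy
  simpa [hy] using hvc.1

theorem exists_isIntegralForm_face_eq_segment (hN : N.FG) (hP : IsRationalPolyhedron N P) {v w : V}
    (h : segment ℝ v w ∈ compactEdges P) :
    ∃ c, IsIntegralForm N c ∧ face P c = segment ℝ v w := by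
  obtain ⟨⟨-, c, hc⟩, -⟩ := h
  have hmid : midpoint ℝ v w ∈ face P c := hc ▸ midpoint_mem_segment v w
  rw [hc]
  refine exists_isIntegralForm_face_eq hN hP hmid fun y hy => ⟨1, one_pos, ?_⟩
  have hsub : segment ℝ v w ⊆ P := fun z hz => (hc ▸ hz : z ∈ face P c).1
  rw [← hc] at hy
  obtain ⟨α, β, hα, hβ, hαβ, rfl⟩ := hy
  refine hsub ⟨β, α, hβ, hα, by linarith, ?_⟩
  obtain rfl : β = 1 - α := by linarith
  rw [midpoint_eq_smul_add, invOf_eq_inv]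
  module

theorem finite_smul_halfOpen_inter [FiniteDimensional ℝ V] [DiscreteTopology N] (r : ℝ) (v w : V) :
    ((r • halfOpen v w) ∩ (N : Set V)).Finite := by
  have : DiscreteTopology N.toAddSubgroup := ‹DiscreteTopology N›
  have hb : Bornology.IsBounded (halfOpen v w) := by
    refine (isCompact_Icc.image (AffineMap.lineMap_continuous (p := v) (q := w)
      (R := ℝ))).isBounded.subset (Set.image_mono Set.Ico_subset_Icc_self)
  have := FiniteDimensional.proper_real V
  exact Metric.finite_isBounded_inter_isClosed ⟨‹DiscreteTopology N›⟩ (hb.smul₀ r)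
    (AddSubgroup.isClosed_of_discrete (H := N.toAddSubgroup))

/-- If `[v, w)` is short, then the lattice length of `[v, w]` is less than one: a multiple
`r (w - v)` with `0 < r ≤ 1` in the lattice would give at least `g` equidistant lattice points
on `g · [v, w)`. -/
theorem IsShort.smul_sub_notMem [FiniteDimensional ℝ V] [DiscreteTopology N] {v w : V}
    (hs : IsShort N v w) (hvw : v ≠ w) {r : ℝ} (hr0 : 0 < r) (hr1 : r ≤ 1) :
    r • (w - v) ∉ N := by
  intro hmem
  set g := edgeIndex N v w with hg
  have hs' : (((g : ℝ) • halfOpen v w) ∩ (N : Set V)).ncard + 1 ≤ g := hs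
  have hne : {g : ℕ | 1 ≤ g ∧ ∃ x ∈ N, x ∈ line[ℝ, (g : ℝ) • v, (g : ℝ) • w]}.Nonempty := by
    by_contra hemp
    have : g = 0 := by
      rw [hg, edgeIndex, Set.not_nonempty_iff_eq_empty.1 hemp, Nat.sInf_empty]
    omega
  obtain ⟨hg1, x, hxN, hxl⟩ : 1 ≤ g ∧ ∃ x ∈ N, x ∈ line[ℝ, (g : ℝ) • v, (g : ℝ) • w] :=
    Nat.sInf_mem hne
  obtain ⟨τ, rfl⟩ := mem_affineSpan_pair_iff_exists_lineMap_eq.1 hxl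
  have hgpos : (0 : ℝ) < g := by exact_mod_cast hg1
  -- On the ray from `g v` through `g w`, the first of the lattice points `x + k r (w - v)`, `k ∈ ℤ`,
  -- where `x` is the lattice point on the line with parameter `τ`.
  set k := ⌈-(τ * g) / r⌉ with hk
  have hk1 : 0 ≤ τ * g + k * r := by
    have := Int.le_ceil (-(τ * g) / r)
    rw [div_le_iff₀ hr0] at this
    linarith
  have hk2 : τ * g + k * r < r := by
    have := Int.ceil_lt_add_one (-(τ * g) / r)
    rw [← hk, ← sub_lt_iff_lt_add, lt_div_iff₀ hr0] at this
    linarith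
  have hsub : (fun j : ℕ => AffineMap.lineMap ((g : ℝ) • v) ((g : ℝ) • w) τ +
      (k + j : ℤ) • r • (w - v)) '' (Set.Iio g) ⊆ ((g : ℝ) • halfOpen v w) ∩ (N : Set V) := by
    rintro _ ⟨j, hj, rfl⟩
    have hj' : (j : ℝ) + 1 ≤ g := by exact_mod_cast Set.mem_Iio.1 hj
    refine ⟨Set.mem_smul_set.2 ⟨_, ⟨(τ * g + k * r + j * r) / g, ⟨by positivity, ?_⟩, rfl⟩, ?_⟩,
      N.add_mem hxN (N.smul_mem _ hmem)⟩
    · rw [div_lt_one hgpos]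
      nlinarith
    · simp only [AffineMap.lineMap_apply_module', smul_add, smul_smul, ← smul_sub,
        ← Int.cast_smul_eq_zsmul ℝ]
      rw [mul_div_cancel₀ _ hgpos.ne']
      push_cast
      module
  have hinj : Set.InjOn (fun j : ℕ => AffineMap.lineMap ((g : ℝ) • v) ((g : ℝ) • w) τ +
      (k + j : ℤ) • r • (w - v)) (Set.Iio g) := by
    intro i _ j _ hij
    have hq : r • (w - v) ≠ 0 := smul_ne_zero hr0.ne' (sub_ne_zero.2 hvw.symm)
    have h1 := add_left_cancel hij
    rw [← Int.cast_smul_eq_zsmul ℝ, ← Int.cast_smul_eq_zsmul ℝ] at h1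
    have h2 := smul_left_injective ℝ hq h1
    push_cast at h2
    exact_mod_cast add_left_cancel h2
  have hcard := Set.ncard_le_ncard hsub (finite_smul_halfOpen_inter g v w)
  rw [hinj.ncard_image] at hcard
  simp at hcard
  omega

/-- A short half open edge contains no lattice point, since its index would be one. -/
theorem IsShort.notMem_of_mem_halfOpen [FiniteDimensional ℝ V] [DiscreteTopology N] {v w x : V}
    (hs : IsShort N v w) (hx : x ∈ halfOpen v w) : x ∉ N := by
  intro hxN
  have hle : edgeIndex N v w ≤ 1 := by
    refine Nat.sInf_le ⟨le_rfl, x, hxN, ?_⟩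
    obtain ⟨r, -, rfl⟩ := hx
    simpa using AffineMap.lineMap_mem_affineSpan_pair r v w
  have hs' : (((edgeIndex N v w : ℝ) • halfOpen v w) ∩ (N : Set V)).ncard + 1
    ≤ edgeIndex N v w := hs
  have h1 : edgeIndex N v w = 1 := by omega
  rw [h1, Nat.cast_one, one_smul] at hs'
  have h0 : (halfOpen v w ∩ (N : Set V)).ncard = 0 := by omega
  have hfin := finite_smul_halfOpen_inter (N := N) 1 v w
  rw [one_smul] at hfin
  rw [Set.ncard_eq_zero hfin] at h0
  exact (h0 ▸ ⟨hx, hxN⟩ : x ∈ (∅ : Set V))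

theorem IsShort.eq_of_mem_segment [FiniteDimensional ℝ V] [DiscreteTopology N] {v w x : V}
    (hs : IsShort N v w) (hx : x ∈ segment ℝ v w) (hxN : x ∈ N) : x = w := by
  rw [segment_eq_image_lineMap] at hx
  obtain ⟨r, ⟨hr0, hr1⟩, rfl⟩ := hx
  rcases hr1.eq_or_lt with rfl | hlt
  · simp
  · exact absurd hxN (hs.notMem_of_mem_halfOpen ⟨r, ⟨hr0, hlt⟩, rfl⟩)

end Lattice

/-! ### Minkowski summands -/

section Summands

variable {V : Type*} [NormedAddCommGroup V] {N : Submodule ℤ V}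
variable {ι : Type*} [Fintype ι] {P : Set V} {Q : ι → Set V}

theorem eq_add_sum_erase [DecidableEq ι] (hsum : P = ∑ i, Q i) (i : ι) :
    P = Q i + ∑ j ∈ Finset.univ.erase i, Q j := by
  rw [hsum, Finset.add_sum_erase _ _ (Finset.mem_univ i)]

theorem sum_mem_of_forall_mem (hsum : P = ∑ i, Q i) {x : ι → V} (hx : ∀ i, x i ∈ Q i) :
    ∑ i, x i ∈ P :=
  hsum ▸ Set.mem_fintype_sum Q _ |>.2 ⟨x, hx, rfl⟩

variable [NormedSpace ℝ V]

theorem sum_mem_face (hsum : P = ∑ i, Q i) {c : Module.Dual ℝ V} {x : ι → V}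
    (hx : ∀ i, x i ∈ face (Q i) c) : ∑ i, x i ∈ face P c := by
  refine ⟨sum_mem_of_forall_mem hsum fun i => (hx i).1, fun y hy => ?_⟩
  rw [hsum, Set.mem_fintype_sum] at hy
  obtain ⟨y, hy, rfl⟩ := hy
  rw [map_sum, map_sum]
  exact Finset.sum_le_sum fun i _ => (hx i).2 _ (hy i)

theorem mem_face_of_sum_mem_face (hsum : P = ∑ i, Q i) {c : Module.Dual ℝ V} {x : ι → V}
    (hx : ∀ i, x i ∈ Q i) (h : ∑ i, x i ∈ face P c) (i : ι) : x i ∈ face (Q i) c := by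
  classical
  refine ⟨hx i, fun y hy => ?_⟩
  have hmem : ∀ j, Function.update x i y j ∈ Q j := by
    intro j
    rcases eq_or_ne j i with rfl | hj
    · simpa using hy
    · simpa [hj] using hx j
  have h1 := h.2 _ (sum_mem_of_forall_mem hsum hmem)
  rw [Finset.sum_update_of_mem (Finset.mem_univ i), ← Finset.add_sum_erase _ _ (Finset.mem_univ i),
    Finset.sdiff_singleton_eq_erase, map_add, map_add] at h1
  linarith

theorem vertexIn_mem (hsum : P = ∑ i, Q i) {v : V} (hv : v ∈ vertices P) (i : ι) :
    vertexIn P (Q i) v ∈ Q i := by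
  classical
  obtain ⟨c, -, hc⟩ := vertexIn_spec (eq_add_sum_erase hsum i) hv
  exact (hc ▸ Set.mem_singleton _ : vertexIn P (Q i) v ∈ face (Q i) c).1

theorem sum_vertexIn (hsum : P = ∑ i, Q i) {v : V} (hv : v ∈ vertices P) :
    ∑ i, vertexIn P (Q i) v = v := by
  classical
  obtain ⟨-, c, hc⟩ := id hv
  have hvc : v ∈ face P c := hc ▸ Set.mem_singleton v
  obtain ⟨x, hx, hxv⟩ := (Set.mem_fintype_sum Q v).1 (hsum ▸ hvc.1)
  have hxf := mem_face_of_sum_mem_face hsum hx (hxv.symm ▸ hvc)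
  rw [← hxv]
  refine Finset.sum_congr rfl fun i _ => ?_
  rw [hxv]
  refine (existsUnique_isVertexIn (eq_add_sum_erase hsum i) hv).unique
    (vertexIn_spec (eq_add_sum_erase hsum i) hv) ⟨c, hc.symm, ?_⟩
  refine Set.eq_singleton_iff_unique_mem.2 ⟨hxf i, fun y hy => ?_⟩
  have hmem : ∀ j, Function.update x i y j ∈ face (Q j) c := by
    intro j
    rcases eq_or_ne j i with rfl | hj
    · simpa using hy
    · simpa [hj] using hxf j
  have h1 := sum_mem_face hsum hmem
  rw [← hc, Set.mem_singleton_iff, ← hxv, Finset.sum_update_of_mem (Finset.mem_univ i),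
    ← Finset.add_sum_erase _ _ (Finset.mem_univ i), Finset.sdiff_singleton_eq_erase] at h1
  exact add_right_cancel h1

theorem vertexIn_mem_face (hsum : P = ∑ i, Q i) {v : V} (hv : v ∈ vertices P)
    {c : Module.Dual ℝ V} (hvc : v ∈ face P c) (i : ι) : vertexIn P (Q i) v ∈ face (Q i) c :=
  mem_face_of_sum_mem_face hsum (vertexIn_mem hsum hv) ((sum_vertexIn hsum hv).symm ▸ hvc) i

theorem vertexIn_sub_vertexIn {Q Q' : Set V} (h : P = Q + Q') {v w : V} (hv : v ∈ vertices P)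
    (hw : w ∈ vertices P) (he : segment ℝ v w ∈ compactEdges P) :
    vertexIn P Q w - vertexIn P Q v = dilationFactor P Q (segment ℝ v w) • (w - v) :=
  (Classical.epsilon_spec (existsUnique_isDilationFactor h he).1.exists).2 v hv w hw rfl

theorem vertexIn_self {v : V} (hv : v ∈ vertices P) : vertexIn P P v = v := by
  have h : P = P + 0 := (add_zero P).symm
  obtain ⟨-, c, hc⟩ := id hv
  exact (existsUnique_isVertexIn h hv).unique (vertexIn_spec h hv) ⟨c, hc.symm, hc.symm⟩

theorem ne_of_segment_mem_compactEdges {v w : V} (he : segment ℝ v w ∈ compactEdges P) :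
    v ≠ w := by
  rintro rfl
  obtain ⟨-, a, -, b, -, hab, h⟩ := he
  rw [segment_same] at h
  have ha : a ∈ ({v} : Set V) := h ▸ left_mem_segment ℝ a b
  have hb : b ∈ ({v} : Set V) := h ▸ right_mem_segment ℝ a b
  exact hab (ha.trans hb.symm)

theorem kodairaSpencer_self : kodairaSpencer N P P = oneParam N P := by
  refine Prod.ext (funext ?_) (funext fun v => ?_)
  · rintro ⟨e, he⟩
    obtain ⟨-, v, hv, w, hw, hvw, rfl⟩ := id he
    have h := vertexIn_sub_vertexIn (add_zero P).symm hv hw he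
    rw [vertexIn_self hv, vertexIn_self hw] at h
    exact (smul_left_injective ℝ (sub_ne_zero.2 hvw.symm) ((one_smul ℝ _).trans h)).symm
  · by_cases h : (v : V) ∈ N <;> simp [kodairaSpencer, oneParam, vertexIn_self v.2, h]

theorem sum_dilationFactor (hsum : P = ∑ i, Q i) {e : Set V} (he : e ∈ compactEdges P) :
    ∑ i, dilationFactor P (Q i) e = 1 := by
  classical
  obtain ⟨-, v, hv, w, hw, hvw, rfl⟩ := id he
  refine smul_left_injective ℝ (sub_ne_zero.2 hvw.symm) ?_
  simp only [Finset.sum_smul, one_smul]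
  rw [← Finset.sum_congr rfl fun i _ =>
    vertexIn_sub_vertexIn (eq_add_sum_erase hsum i) hv hw he, Finset.sum_sub_distrib,
    sum_vertexIn hsum hv, sum_vertexIn hsum hw]

theorem eq_or_eq_of_mem_vertices_of_mem_segment {v w x : V} (hx : x ∈ vertices P) (hv : v ∈ P)
    (hw : w ∈ P) (hmem : x ∈ segment ℝ v w) : x = v ∨ x = w := by
  obtain ⟨-, c, hc⟩ := hx
  have hxc : x ∈ face P c := hc ▸ Set.mem_singleton x
  obtain ⟨α, β, hα, hβ, hαβ, rfl⟩ := hmem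
  have hcv := hxc.2 v hv
  have hcw := hxc.2 w hw
  rcases hα.eq_or_lt with rfl | hα
  · right
    simp_all
  · left
    simp only [map_add, map_smul, smul_eq_mul] at hcv hcw
    obtain rfl : β = 1 - α := by linarith
    have hle : c v ≤ c (α • v + (1 - α) • w) := by
      simp only [map_add, map_smul, smul_eq_mul]
      nlinarith [mul_nonneg hβ (sub_nonneg.2 hcw)]
    have : v ∈ face P c := ⟨hv, fun y hy => hle.trans (hxc.2 y hy)⟩
    rw [← hc, Set.mem_singleton_iff] at this
    exact this.symm

theorem mem_vertices_of_segment_mem_compactEdges {v w : V} (he : segment ℝ v w ∈ compactEdges P) :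
    v ∈ vertices P ∧ w ∈ vertices P := by
  obtain ⟨⟨-, c, hc⟩, a, ha, b, hb, hab, h⟩ := he
  have hsub : segment ℝ v w ⊆ P := fun z hz => (hc ▸ hz : z ∈ face P c).1
  have hv := hsub (left_mem_segment ℝ v w)
  have hw := hsub (right_mem_segment ℝ v w)
  rcases eq_or_eq_of_mem_vertices_of_mem_segment ha hv hw (h ▸ left_mem_segment ℝ a b)
    with rfl | rfl <;>
  rcases eq_or_eq_of_mem_vertices_of_mem_segment hb hv hw (h ▸ right_mem_segment ℝ _ b)
    with rfl | rfl
  · exact absurd rfl hab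
  · exact ⟨ha, hb⟩
  · exact ⟨hb, ha⟩
  · exact absurd rfl hab

/-- The edges of a Minkowski summand corresponding to the boundary of a two-face close up, because
they are differences of consecutive vertices of the summand. -/
theorem dilationFactor_mem_edgeSpace {Q Q' : Set V} (h : P = Q + Q') :
    (fun e : compactEdges P => dilationFactor P Q e) ∈ edgeSpace P := by
  intro F _ z
  have hstep : ∀ k < z.n, dilationFactor P Q (segment ℝ (z.u k) (z.u (k + 1))) •
      (z.u (k + 1) - z.u k) = vertexIn P Q (z.u (k + 1)) - vertexIn P Q (z.u k) := fun k hk =>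
    have hk' := mem_vertices_of_segment_mem_compactEdges (z.edge_mem k hk)
    (vertexIn_sub_vertexIn h hk'.1 hk'.2 (z.edge_mem k hk)).symm
  rw [Finset.sum_congr rfl fun (k : Fin z.n) _ => hstep k k.2,
    Fin.sum_univ_eq_sum_range fun k => vertexIn P Q (z.u (k + 1)) - vertexIn P Q (z.u k),
    Finset.sum_range_sub fun k => vertexIn P Q (z.u k), z.closed, sub_self]

/-- The coordinate `s_v` of a sum of Kodaira-Spencer evaluations counts the summands whose vertex
corresponding to `v` is not a lattice point. -/
theorem sum_kodairaSpencer_snd (v : vertices P) [DecidablePred fun i => vertexIn P (Q i) v ∉ N] :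
    (∑ i, kodairaSpencer N P (Q i)).2 v =
      ((Finset.univ.filter fun i => vertexIn P (Q i) v ∉ N).card : ℝ) := by
  rw [Prod.snd_sum, Finset.sum_apply, Finset.card_filter, Nat.cast_sum]
  refine Finset.sum_congr rfl fun i _ => ?_
  by_cases h : vertexIn P (Q i) v ∈ N <;> simp [kodairaSpencer, h]

theorem oneParam_snd_le_one (v : vertices P) : (oneParam N P).2 v ≤ 1 := by
  simp only [oneParam]
  split_ifs <;> norm_num

end Summands

/-! ### Lattice friendly decompositions -/

section LatticeFriendly

variable {V : Type*} [NormedAddCommGroup V] [NormedSpace ℝ V] {N : Submodule ℤ V} {P : Set V}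
variable {m : ℕ} {Q : Fin (m + 1) → Set V}

/-- For a form `c` that is nonnegative on the tail cone, the face `face P c` has a vertex `v`, and
the coordinate `s_v` of the equation of Kodaira-Spencer evaluations says that all but one of the
corresponding vertices of the summands are lattice points. -/
theorem isLatticeFriendly_of_kodairaSpencer_eq_sum (hP : IsRationalPolyhedron N P)
    (hvert : (vertices P).Nonempty) (hsum : P = ∑ i, Q i) (htail : ∀ i, tail (Q i) = tail P)
    (hκ : kodairaSpencer N P P = ∑ i, kodairaSpencer N P (Q i)) : IsLatticeFriendly N P Q := by
  classical
  refine ⟨fun i j => (htail i).trans (htail j).symm, fun c hc _ => ?_⟩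
  obtain ⟨S, -, hPS⟩ := hP
  obtain ⟨v, hv, hvc⟩ := exists_vertex_mem_face hPS hvert hc
  have hcard : (Finset.univ.filter fun i => vertexIn P (Q i) v ∉ N).card ≤ 1 := by
    have h := sum_kodairaSpencer_snd (N := N) (Q := Q) ⟨v, hv⟩
    rw [← hκ, kodairaSpencer_self] at h
    exact_mod_cast h ▸ oneParam_snd_le_one (N := N) ⟨v, hv⟩
  obtain ⟨μ, hμ⟩ := Finset.card_le_one_iff_subset_singleton.1 hcard
  refine ⟨μ, fun i hi => ⟨vertexIn P (Q i) v, vertexIn_mem_face hsum hv hvc i, ?_⟩⟩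
  by_contra h
  exact hi (Finset.mem_singleton.1 (hμ (Finset.mem_filter.2 ⟨Finset.mem_univ i, h⟩)))

/-- In a lattice friendly decomposition, at most one of the summands of a vertex is not a lattice
point. -/
theorem IsLatticeFriendly.exists_forall_vertexIn_mem (hN : N.FG) (hP : IsRationalPolyhedron N P)
    (hsum : P = ∑ i, Q i) (hLF : IsLatticeFriendly N P Q) {v : V} (hv : v ∈ vertices P) :
    ∃ μ, ∀ i, i ≠ μ → vertexIn P (Q i) v ∈ N := by
  classical
  obtain ⟨c, hcN, hc⟩ := exists_isIntegralForm_face_eq_singleton hN hP hv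
  have hvc : v ∈ face P c := hc ▸ Set.mem_singleton v
  obtain ⟨μ, hμ⟩ := hLF.2 c (mem_dualCone_tail_of_mem_face hvc) hcN
  refine ⟨μ, fun i hi => ?_⟩
  obtain ⟨x, hx, hxN⟩ := hμ i hi
  have hmem : ∀ j, Function.update (fun j => vertexIn P (Q j) v) i x j ∈ face (Q j) c := by
    intro j
    rcases eq_or_ne j i with rfl | hj
    · simpa using hx
    · simpa [hj] using vertexIn_mem_face hsum hv hvc j
  have h1 := sum_mem_face hsum hmem
  rw [hc, Set.mem_singleton_iff, Finset.sum_update_of_mem (Finset.mem_univ i)] at h1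
  nth_rewrite 2 [← sum_vertexIn hsum hv] at h1
  rw [← Finset.add_sum_erase _ _ (Finset.mem_univ i), Finset.sdiff_singleton_eq_erase] at h1
  exact add_right_cancel h1 ▸ hxN

theorem IsLatticeFriendly.vertexIn_mem_of_ne (hN : N.FG) (hP : IsRationalPolyhedron N P)
    (hsum : P = ∑ i, Q i) (hLF : IsLatticeFriendly N P Q) {v : V} (hv : v ∈ vertices P)
    {i j : Fin (m + 1)} (hi : vertexIn P (Q i) v ∉ N) (hj : j ≠ i) : vertexIn P (Q j) v ∈ N := by
  obtain ⟨μ, hμ⟩ := hLF.exists_forall_vertexIn_mem hN hP hsum hv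
  obtain rfl : i = μ := by
    by_contra h
    exact hi (hμ i h)
  exact hμ j hj

theorem IsLatticeFriendly.vertexIn_mem_of_mem (hN : N.FG) (hP : IsRationalPolyhedron N P)
    (hsum : P = ∑ i, Q i) (hLF : IsLatticeFriendly N P Q) {v : V} (hv : v ∈ vertices P)
    (hvN : v ∈ N) (i : Fin (m + 1)) : vertexIn P (Q i) v ∈ N := by
  by_contra h
  rw [← sum_vertexIn hsum hv, ← Finset.add_sum_erase _ _ (Finset.mem_univ i)] at hvN
  exact h ((N.add_mem_iff_left (N.sum_mem fun j hj =>
    hLF.vertexIn_mem_of_ne hN hP hsum hv h (Finset.ne_of_mem_erase hj))).1 hvN)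

theorem IsLatticeFriendly.exists_vertexIn_notMem (hsum : P = ∑ i, Q i) {v : V}
    (hv : v ∈ vertices P) (hvN : v ∉ N) : ∃ i, vertexIn P (Q i) v ∉ N := by
  by_contra! h
  exact hvN (sum_vertexIn hsum hv ▸ N.sum_mem fun i _ => h i)

/-- If the compact edge `[v, w]` contains no lattice point, then the summand that violates
integrality along this edge does so at both ends. -/
theorem IsLatticeFriendly.vertexIn_mem_of_segment (hN : N.FG) (hP : IsRationalPolyhedron N P)
    (hsum : P = ∑ i, Q i) (hLF : IsLatticeFriendly N P Q) {v w : V}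
    (he : segment ℝ v w ∈ compactEdges P) (hdisj : segment ℝ v w ∩ (N : Set V) = ∅)
    {i : Fin (m + 1)} (hi : vertexIn P (Q i) v ∈ N) : vertexIn P (Q i) w ∈ N := by
  classical
  obtain ⟨hv, hw⟩ := mem_vertices_of_segment_mem_compactEdges he
  obtain ⟨c, hcN, hc⟩ := exists_isIntegralForm_face_eq_segment hN hP he
  have hvc : v ∈ face P c := hc ▸ left_mem_segment ℝ v w
  have hwc : w ∈ face P c := hc ▸ right_mem_segment ℝ v w
  obtain ⟨μ, hμ⟩ := hLF.2 c (mem_dualCone_tail_of_mem_face hvc) hcN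
  choose! x hx using hμ
  have key : ∀ u ∈ vertices P, u ∈ face P c → vertexIn P (Q μ) u ∉ N := by
    intro u hu huc h
    have hmem : ∀ j, Function.update x μ (vertexIn P (Q μ) u) j ∈ face (Q j) c ∩ (N : Set V) := by
      intro j
      rcases eq_or_ne j μ with rfl | hj
      · simpa using ⟨vertexIn_mem_face hsum hu huc j, h⟩
      · simpa [hj] using hx j hj
    have h1 := sum_mem_face hsum fun j => (hmem j).1
    rw [hc] at h1
    exact (hdisj ▸ ⟨h1, N.sum_mem fun j _ => (hmem j).2⟩ :
      ∑ j, Function.update x μ (vertexIn P (Q μ) u) j ∈ (∅ : Set V))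
  refine hLF.vertexIn_mem_of_ne hN hP hsum hw (key w hw hwc) ?_
  rintro rfl
  exact key v hv hvc hi

theorem IsLatticeFriendly.kodairaSpencer_eq_sum (hN : N.FG) (hP : IsRationalPolyhedron N P)
    (hsum : P = ∑ i, Q i) (hLF : IsLatticeFriendly N P Q) :
    kodairaSpencer N P P = ∑ i, kodairaSpencer N P (Q i) := by
  classical
  rw [kodairaSpencer_self]
  refine Prod.ext (funext fun e => ?_) (funext fun v => ?_)
  · rw [Prod.fst_sum, Finset.sum_apply]
    exact (sum_dilationFactor hsum e.2).symm
  · rw [sum_kodairaSpencer_snd]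
    simp only [oneParam]
    split_ifs with hv
    · simp [hLF.vertexIn_mem_of_mem hN hP hsum v.2 hv]
    · obtain ⟨μ, hμ⟩ := IsLatticeFriendly.exists_vertexIn_notMem hsum v.2 hv
      have : (Finset.univ.filter fun i => vertexIn P (Q i) v ∉ N) = {μ} := by
        ext i
        simp only [Finset.mem_filter, Finset.mem_univ, true_and, Finset.mem_singleton]
        refine ⟨fun hi => ?_, fun hi => hi ▸ hμ⟩
        by_contra h
        exact hi (hLF.vertexIn_mem_of_ne hN hP hsum v.2 hμ h)
      rw [this, Finset.card_singleton, Nat.cast_one]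

/-- Let `[v, w)` be short. A summand whose vertex at `v` is integral also has an integral vertex
at `w`, so it contracts the edge, whose lattice length is less than one. -/
theorem IsLatticeFriendly.dilationFactor_eq_zero [FiniteDimensional ℝ V] [DiscreteTopology N]
    (hN : N.FG) (hP : IsRationalPolyhedron N P) (hsum : P = ∑ i, Q i)
    (hLF : IsLatticeFriendly N P Q) {v w : V} (he : segment ℝ v w ∈ compactEdges P)
    (hs : IsShort N v w) {i : Fin (m + 1)} (hi : vertexIn P (Q i) v ∈ N) :
    dilationFactor P (Q i) (segment ℝ v w) = 0 := by
  classical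
  obtain ⟨hv, hw⟩ := mem_vertices_of_segment_mem_compactEdges he
  have hwi : vertexIn P (Q i) w ∈ N := by
    by_cases hdisj : segment ℝ v w ∩ (N : Set V) = ∅
    · exact hLF.vertexIn_mem_of_segment hN hP hsum he hdisj hi
    · obtain ⟨x, hx, hxN⟩ := Set.nonempty_iff_ne_empty.2 hdisj
      exact hLF.vertexIn_mem_of_mem hN hP hsum hw (hs.eq_of_mem_segment hx hxN ▸ hxN) i
  obtain ⟨hex, hle⟩ := existsUnique_isDilationFactor (eq_add_sum_erase hsum i) he
  have h0 : 0 ≤ dilationFactor P (Q i) (segment ℝ v w) := (Classical.epsilon_spec hex.exists).1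
  rcases h0.eq_or_lt with h0 | h0
  · exact h0.symm
  · refine absurd ?_ (hs.smul_sub_notMem (ne_of_segment_mem_compactEdges he) h0 hle)
    rw [← vertexIn_sub_vertexIn (eq_add_sum_erase hsum i) hv hw he]
    exact N.sub_mem hwi hi

theorem IsLatticeFriendly.kodairaSpencer_mem_paramLattice [FiniteDimensional ℝ V]
    [DiscreteTopology N] (hN : N.FG) (hP : IsRationalPolyhedron N P) (hsum : P = ∑ i, Q i)
    (hLF : IsLatticeFriendly N P Q) (i : Fin (m + 1)) :
    kodairaSpencer N P (Q i) ∈ paramLattice N P := by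
  classical
  have hs0 : ∀ v : vertices P, vertexIn P (Q i) v ∈ N → (kodairaSpencer N P (Q i)).2 v = 0 :=
    fun v hv => by simp [kodairaSpencer, hv]
  have hs1 : ∀ v : vertices P, vertexIn P (Q i) v ∉ N → (kodairaSpencer N P (Q i)).2 v = 1 :=
    fun v hv => by simp [kodairaSpencer, hv]
  have hadd := eq_add_sum_erase hsum i
  refine ⟨⟨dilationFactor_mem_edgeSpace hadd, fun v hv => ?_, fun v w he hdisj => ?_,
    fun v w he hs => ?_⟩, fun v => ?_, fun v w he => ?_⟩
  · exact hs0 v (hLF.vertexIn_mem_of_mem hN hP hsum v.2 hv i)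
  · by_cases hv : vertexIn P (Q i) v ∈ N
    · rw [hs0 v hv, hs0 w (hLF.vertexIn_mem_of_segment hN hP hsum he hdisj hv)]
    · rw [segment_symm] at he hdisj
      rw [hs1 v hv, hs1 w (mt (hLF.vertexIn_mem_of_segment hN hP hsum he hdisj) hv)]
  · change _ = dilationFactor P (Q i) (segment ℝ (v : V) w)
    by_cases hv : vertexIn P (Q i) v ∈ N
    · rw [hs0 v hv, hLF.dilationFactor_eq_zero hN hP hsum he hs hv]
    · rw [hs1 v hv, ← sum_dilationFactor hsum he, Finset.sum_eq_single i]
      · exact fun j _ hj => hLF.dilationFactor_eq_zero hN hP hsum he hs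
          (hLF.vertexIn_mem_of_ne hN hP hsum v.2 hv hj)
      · simp
  · by_cases hv : vertexIn P (Q i) v ∈ N
    · exact ⟨0, by rw [hs0 v hv, Int.cast_zero]⟩
    · exact ⟨1, by rw [hs1 v hv, Int.cast_one]⟩
  · change (dilationFactor P (Q i) (segment ℝ (v : V) w) - _) • (v : V) -
      (dilationFactor P (Q i) (segment ℝ (v : V) w) - _) • (w : V) ∈ N
    -- The element in question is the difference of the lattice points `u(Q i) - s_u u`.
    have hmem : ∀ u : vertices P,
        vertexIn P (Q i) u - (kodairaSpencer N P (Q i)).2 u • (u : V) ∈ N := by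
      intro u
      by_cases hu : vertexIn P (Q i) u ∈ N
      · rwa [hs0 u hu, zero_smul, sub_zero]
      · rw [hs1 u hu, one_smul, ← N.neg_mem_iff, neg_sub]
        nth_rewrite 1 [← sum_vertexIn hsum u.2]
        rw [← Finset.add_sum_erase _ _ (Finset.mem_univ i), add_sub_cancel_left]
        exact N.sum_mem fun j hj =>
          hLF.vertexIn_mem_of_ne hN hP hsum u.2 hu (Finset.ne_of_mem_erase hj)
    convert N.sub_mem (hmem v) (hmem w) using 1
    have h := vertexIn_sub_vertexIn hadd v.2 w.2 he
    rw [smul_sub] at h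
    rw [sub_smul, sub_smul, ← sub_eq_zero]
    rw [← sub_eq_zero] at h
    rw [← h]
    abel

end LatticeFriendly

end LatticeMinkowski

theorem mainTheorem3 {V : Type*} [NormedAddCommGroup V] [NormedSpace ℝ V]
    [FiniteDimensional ℝ V] (N : Submodule ℤ V) [DiscreteTopology N] [IsZLattice ℝ N]
    (P : Set V) (hP : LatticeMinkowski.IsRationalPolyhedron N P)
    (hvert : (LatticeMinkowski.vertices P).Nonempty)
    (m : ℕ) (Q : Fin (m + 1) → Set V)
    (hQ : ∀ i, LatticeMinkowski.IsPolyhedron (Q i))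
    (hsum : P = ∑ i, Q i)
    (htail : ∀ i, LatticeMinkowski.tail (Q i) = LatticeMinkowski.tail P) :
    LatticeMinkowski.kodairaSpencer N P P = LatticeMinkowski.oneParam N P ∧
    (LatticeMinkowski.IsLatticeFriendly N P Q ↔
      LatticeMinkowski.kodairaSpencer N P P = ∑ i, LatticeMinkowski.kodairaSpencer N P (Q i) ∧
      ∀ i, LatticeMinkowski.kodairaSpencer N P (Q i) ∈ LatticeMinkowski.paramLattice N P) := by
  have hN : N.FG := ZLattice.FG ℝ N
  exact ⟨LatticeMinkowski.kodairaSpencer_self,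
    fun h => ⟨h.kodairaSpencer_eq_sum hN hP hsum, h.kodairaSpencer_mem_paramLattice hN hP hsum⟩,
    fun h => LatticeMinkowski.isLatticeFriendly_of_kodairaSpencer_eq_sum hP hvert hsum htail h.1⟩
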